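/- Let $K$ be an algebraically closed field of characteristic $0$, let $k\ge 0$, $s\ge 1$ and $r\geq s-1$ be integers, put $w=\min\{k,s-1\}$, and let $X\subset\mathbb{P}^r$ be an irreducible projective variety not contained in any hyperplane. Write $\varphi:\mathbb{P}^k\times\mathbb{P}^r\to\mathbb{P}^N$, $N=rk+r+k$, for the Segre embedding $\varphi(\Lambda,P)=(\lambda_0P,\dots,\lambda_kP)$ and $Seg(\mathbb{P}^k\times X)=\varphi(\mathbb{P}^k\times X)$. Let $\sigma_s(Seg(\mathbb{P}^k\times X))\subset\mathbb{P}^N$ be the Zariski closure of the union of the linear spans of $s$ distinct points of $Seg(\mathbb{P}^k\times X)$, and let $GS_X(w,s)$ be the Zariski closure, in the Grassmannian $\mathbb{G}(w,r)$ of projective $w$-spaces in $\mathbb{P}^r$, of the set of $w$-spaces contained in the linear span of $s$ linearly independent points of $X$. Write a point of $\mathbb{P}^N$ as $A=(A_0,\dots,A_k)$ with $A_j\in K^{r+1}$, and let $$\Phi:\sigma_s(Seg(\mathbb{P}^k\times X))\dashrightarrow GS_X(w,s),\qquad \Phi(A)=\langle A_0,\dots,A_k\rangle,$$ be defined at the points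 $A$ for which $\langle A_0,\dots,A_k\rangle$ has projective dimension $w$. (If $A=\sum_i\varphi(\Lambda_i,P_i)$, then $A_j=\sum_i\lambda_{i,j}P_i$.) Then for a general $\Pi\in GS_X(w,s)$ and a general $B\in\Phi^{-1}(\Pi)$ the two sets $$\mathcal{E}(\Pi)=\{(P_1,\dots,P_s)\in X^s \mid \Pi\subset\langle P_1,\dots,P_s\rangle\},$$ $$\mathcal{E}(B)=\{(P_1,\dots,P_s)\in X^s \mid \exists\,\mathcal{N}_1,\dots,\mathcal{N}_s\in\mathbb{P}^k \text{ with } B\in\langle \varphi(\mathcal{N}_1,P_1),\dots,\varphi(\mathcal{N}_s,P_s)\rangle\}$$ have the same cardinality. Here "general" means: outside a Zariski closed set whose complement in $GS_X(w,s)$ (respectively in $\Phi^{-1}(\Pi)$) is nonempty and dense; in particular $\Phi^{-1}(\Pi)\neq\emptyset$ for general $\Pi$. -/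

import Mathlib

open scoped LinearAlgebra.Projectivization

noncomputable section

namespace GrassmannSecant

variable {K : Type*} [Field K]

/-! ### Zariski topologies -/

/-- The Zariski topology on the projective space of `ι → K`: the basic open sets are the
non-vanishing loci of homogeneous polynomials (whether a homogeneous polynomial vanishes at a point
does not depend on the vector representing the point). -/
instance zariskiProj {ι : Type*} : TopologicalSpace (ℙ K (ι → K)) :=
  TopologicalSpace.generateFrom
    {U | ∃ (d : ℕ) (F : MvPolynomial ι K), F.IsHomogeneous d ∧
      U = {x | MvPolynomial.eval x.rep F ≠ 0}}

/-- The Grassmannian of projective `w`-dimensional linear subspaces of `ℙ^r`, that is, of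
`(w + 1)`-dimensional linear subspaces of `K^(r+1)`. -/
def Grass (K : Type*) [Field K] (w r : ℕ) : Type _ :=
  {W : Submodule K (Fin (r + 1) → K) // Module.finrank K W = w + 1}

/-- The Plücker coordinates (maximal minors) of a `(w + 1)`-tuple of vectors of `K^(r+1)`. -/
def pluecker {w r : ℕ} (v : Fin (w + 1) → Fin (r + 1) → K)
    (I : Fin (w + 1) ↪o Fin (r + 1)) : K :=
  Matrix.det (Matrix.of fun i j => v i (I j))

/-- The Zariski topology on the Grassmannian, coming from its Plücker embedding: the basic open sets
are the non-vanishing loci of homogeneous polynomials in the Plücker coordinates. The choice of the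
basis `v` of the subspace multiplies all Plücker coordinates by one nonzero scalar. -/
instance zariskiGrass {w r : ℕ} : TopologicalSpace (Grass K w r) :=
  TopologicalSpace.generateFrom
    {U | ∃ (d : ℕ) (F : MvPolynomial (Fin (w + 1) ↪o Fin (r + 1)) K), F.IsHomogeneous d ∧
      U = {W | ∃ v : Fin (w + 1) → Fin (r + 1) → K,
        Submodule.span K (Set.range v) = W.1 ∧ MvPolynomial.eval (pluecker v) F ≠ 0}}

/-- `p` holds for the general element of `T`: the exceptions lie in a closed set `Z`
whose complement in `T` is nonempty and dense in `T`. -/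
def ForGeneral {α : Type*} [TopologicalSpace α] (T : Set α) (p : α → Prop) : Prop :=
  ∃ Z : Set α, IsClosed Z ∧ (T \ Z).Nonempty ∧ T ⊆ closure (T \ Z) ∧ ∀ x ∈ T \ Z, p x

/-! ### Linear spans, secant varieties and Grassmann secant varieties -/

/-- The linear span of a family of points of a projective space, as a linear subspace of the
underlying vector space. -/
def linSpan {V : Type*} [AddCommGroup V] [Module K V] {ι : Type*} (P : ι → ℙ K V) :
    Submodule K V :=
  ⨆ i, (P i).submodule

/-- An irreducible non-degenerate projective variety in `ℙ^r`: a Zariski closed irreducible set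
which is contained in no hyperplane. -/
structure IsNondegenerateVariety {r : ℕ} (X : Set (ℙ K (Fin (r + 1) → K))) : Prop where
  isClosed : IsClosed X
  isIrreducible : IsIrreducible X
  span_eq_top : linSpan (fun P : X => P.1) = ⊤

/-- The `s`-th secant variety: the Zariski closure of the union of the spans of `s` distinct
points of `Y`. -/
def secantVariety {ι : Type*} (Y : Set (ℙ K (ι → K))) (s : ℕ) : Set (ℙ K (ι → K)) :=
  closure {A | ∃ P : Fin s → ℙ K (ι → K), Function.Injective P ∧ (∀ i, P i ∈ Y) ∧
    A.submodule ≤ linSpan P}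

/-- The Grassmann secant variety `GS_X(w,s)`: the Zariski closure in the Grassmannian of the set of
`w`-spaces lying in the span of `s` independent points of `X`. -/
def grassmannSecant {r : ℕ} (X : Set (ℙ K (Fin (r + 1) → K))) (w s : ℕ) : Set (Grass K w r) :=
  closure {L | ∃ P : Fin s → ℙ K (Fin (r + 1) → K), Projectivization.Independent P ∧
    (∀ i, P i ∈ X) ∧ L.1 ≤ linSpan P}

/-! ### The Segre embedding and the map `Φ` -/

theorem segre_ne_zero {ι κ : Type*} (a : ℙ K (κ → K)) (x : ℙ K (ι → K)) :
    (fun p : κ × ι => a.rep p.1 * x.rep p.2) ≠ 0 := by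
  obtain ⟨i, hi⟩ := Function.ne_iff.1 a.rep_nonzero
  obtain ⟨j, hj⟩ := Function.ne_iff.1 x.rep_nonzero
  exact Function.ne_iff.2 ⟨(i, j), mul_ne_zero hi hj⟩

/-- The Segre embedding `φ(Λ, P) = (λ_0 P, …, λ_k P)`. -/
def segre {ι κ : Type*} (a : ℙ K (κ → K)) (x : ℙ K (ι → K)) : ℙ K (κ × ι → K) :=
  Projectivization.mk K (fun p : κ × ι => a.rep p.1 * x.rep p.2) (segre_ne_zero a x)

/-- The Segre variety `Seg(ℙ^k × X)` in `ℙ^N`, with `N + 1 = (k + 1) * (r + 1)`. -/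
def segreVariety {r : ℕ} (k : ℕ) (X : Set (ℙ K (Fin (r + 1) → K))) :
    Set (ℙ K (Fin (k + 1) × Fin (r + 1) → K)) :=
  {A | ∃ (a : ℙ K (Fin (k + 1) → K)) (x : ℙ K (Fin (r + 1) → K)), x ∈ X ∧ A = segre a x}

/-- The span of the `k + 1` vectors `A_0, …, A_k` of `K^(r+1)` of which the coordinate vector of
`A` is composed. If `A = φ(Λ_1, P_1) + ⋯ + φ(Λ_s, P_s)`, then `A_j = λ_{1,j} P_1 + ⋯ + λ_{s,j} P_s`. -/
def rowSpan {k r : ℕ} (A : ℙ K (Fin (k + 1) × Fin (r + 1) → K)) :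
    Submodule K (Fin (r + 1) → K) :=
  Submodule.span K (Set.range fun (i : Fin (k + 1)) (j : Fin (r + 1)) => A.rep (i, j))

/-- The domain of the rational map `Φ`: the points `A` of `σ_s(Seg(ℙ^k × X))` for which
`⟨A_0, …, A_k⟩` has projective dimension `w = min(k, s - 1)`. -/
def phiDomain {r : ℕ} (X : Set (ℙ K (Fin (r + 1) → K))) (k s : ℕ) :
    Set (ℙ K (Fin (k + 1) × Fin (r + 1) → K)) :=
  {A | A ∈ secantVariety (segreVariety k X) s ∧
    Module.finrank K (rowSpan A) = min k (s - 1) + 1}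

/-- The map `Φ`, `A ↦ ⟨A_0, …, A_k⟩`, on its domain in `σ_s(Seg(ℙ^k × X))`. -/
def phi {r : ℕ} (X : Set (ℙ K (Fin (r + 1) → K))) (k s : ℕ) (A : phiDomain X k s) :
    Grass K (min k (s - 1)) r :=
  ⟨rowSpan A.1, A.2.2⟩

/-- The fibre `Φ⁻¹(Π)`, as a subset of `ℙ^N`. -/
def phiFiber {r : ℕ} (X : Set (ℙ K (Fin (r + 1) → K))) (k s : ℕ)
    (L : Grass K (min k (s - 1)) r) : Set (ℙ K (Fin (k + 1) × Fin (r + 1) → K)) :=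
  Subtype.val '' (phi X k s ⁻¹' {L})

/-! ### The two sets of decompositions -/

/-- The set `ℰ(Π)` of the `s`-tuples of points of `X` whose span contains `Π`. -/
def decompSpace {r w : ℕ} (X : Set (ℙ K (Fin (r + 1) → K))) (s : ℕ) (L : Grass K w r) :
    Set (Fin s → ℙ K (Fin (r + 1) → K)) :=
  {P | (∀ i, P i ∈ X) ∧ L.1 ≤ linSpan P}

/-- The set `ℰ(B)` of the `s`-tuples `(P_1, …, P_s)` of points of `X` such that `B` lies in the span
of `φ(N_1, P_1), …, φ(N_s, P_s)` for some points `N_1, …, N_s` of `ℙ^k`. -/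
def decompPoint {r k : ℕ} (X : Set (ℙ K (Fin (r + 1) → K))) (s : ℕ)
    (B : ℙ K (Fin (k + 1) × Fin (r + 1) → K)) : Set (Fin s → ℙ K (Fin (r + 1) → K)) :=
  {P | (∀ i, P i ∈ X) ∧ ∃ N : Fin s → ℙ K (Fin (k + 1) → K),
    B.submodule ≤ linSpan fun i => segre (N i) (P i)}

end GrassmannSecant

end

open GrassmannSecant

namespace GrassmannSecant

open MvPolynomial

variable {K : Type*} [Field K]

/-! ### Rows of points of `ℙ^N` and the two sets of decompositions -/

/-! The two sets are equal for every `B` in the fibre over `Π`. A combination of the points `φ(N_i,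
P_i)` has rows that are combinations of the `P_i`; conversely, if every row lies in `⟨P_1, …, P_s⟩`,
the coefficients of `P_l` in the rows form a vector that serves as `N_l`. So `B` lies in a span of
such Segre points exactly when its rows, which span `Π`, lie in `⟨P_1, …, P_s⟩`
(`rowSpan_le_linSpan_iff`). Both exceptional sets can therefore be empty, and only nonemptiness
remains. `GS_X(w,s)` is nonempty because `X` spans. A fibre over a limit point of `GS_X(w,s)` needs
an argument: over each Plücker chart `Φ` has a continuous section (`continuous_chartSection`), which
sends subspaces of spans of independent points into the union of secant spans, hence limits into its
closure (`phiFiber_nonempty`). -/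

theorem rowSpan_mk {k r : ℕ} (x : Fin (k + 1) × Fin (r + 1) → K) (hx : x ≠ 0) :
    rowSpan (Projectivization.mk K x hx) =
      Submodule.span K (Set.range fun (i : Fin (k + 1)) (j : Fin (r + 1)) => x (i, j)) := by
  obtain ⟨c, hc⟩ := Projectivization.exists_smul_eq_mk_rep K x hx
  have hrow : (fun (i : Fin (k + 1)) (j : Fin (r + 1)) => (Projectivization.mk K x hx).rep (i, j)) =
      fun i => c • fun j => x (i, j) := by
    rw [← hc]; rfl
  rw [rowSpan, hrow]
  apply le_antisymm
  · rw [Submodule.span_le]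
    rintro _ ⟨i, rfl⟩
    exact Submodule.smul_mem _ (c : K) (Submodule.subset_span ⟨i, rfl⟩)
  · rw [Submodule.span_le]
    rintro _ ⟨i, rfl⟩
    have h := Submodule.smul_mem (Submodule.span K (Set.range fun i => c • fun j => x (i, j)))
      ((c⁻¹ : Kˣ) : K) (Submodule.subset_span ⟨i, rfl⟩)
    have e : ((c⁻¹ : Kˣ) : K) • (c • fun j => x (i, j)) = fun j => x (i, j) := by
      change c⁻¹ • (c • fun j => x (i, j)) = _
      rw [inv_smul_smul]
    rwa [e] at h

theorem mem_linSpan_iff {V ι : Type*} [AddCommGroup V] [Module K V] [Fintype ι] (P : ι → ℙ K V)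
    (x : V) : x ∈ linSpan P ↔ ∃ c : ι → K, ∑ i, c i • (P i).rep = x := by
  have h : linSpan P = Submodule.span K (Set.range fun i => (P i).rep) := by
    rw [linSpan, Submodule.span_range_eq_iSup]
    simp only [Projectivization.submodule_eq]
  rw [h, Submodule.mem_span_range_iff_exists_fun]

theorem submodule_le_iff {V : Type*} [AddCommGroup V] [Module K V] (A : ℙ K V)
    (W : Submodule K V) : A.submodule ≤ W ↔ A.rep ∈ W := by
  rw [Projectivization.submodule_eq, Submodule.span_singleton_le_iff_mem]

theorem exists_segre_rep {ι κ : Type*} (a : ℙ K (κ → K)) (x : ℙ K (ι → K)) :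
    ∃ c : Kˣ, ∀ p : κ × ι, (segre a x).rep p = c * (a.rep p.1 * x.rep p.2) := by
  obtain ⟨c, hc⟩ := Projectivization.exists_smul_eq_mk_rep K _ (segre_ne_zero a x)
  exact ⟨c, fun p => (congrFun hc p).symm⟩

/-- A point `B` lies in the span of points `φ(N_i, P_i)` for suitable `N_i` exactly when its rows
lie in the span of the `P_i`. -/
theorem rowSpan_le_linSpan_iff {k r s : ℕ} (B : ℙ K (Fin (k + 1) × Fin (r + 1) → K))
    (P : Fin s → ℙ K (Fin (r + 1) → K)) :
    rowSpan B ≤ linSpan P ↔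
      ∃ N : Fin s → ℙ K (Fin (k + 1) → K), B.submodule ≤ linSpan fun i => segre (N i) (P i) := by
  simp only [submodule_le_iff, mem_linSpan_iff]
  rw [rowSpan, Submodule.span_le]
  constructor
  · intro h
    have h' : ∀ i : Fin (k + 1), ∃ c : Fin s → K,
        ∑ l, c l • (P l).rep = fun j => B.rep (i, j) :=
      fun i => (mem_linSpan_iff P _).1 (h ⟨i, rfl⟩)
    choose c hc using h'
    have hN : ∀ l : Fin s, ∃ (N : ℙ K (Fin (k + 1) → K)) (t : K),
        ∀ p : Fin (k + 1) × Fin (r + 1), t * (segre N (P l)).rep p = c p.1 l * (P l).rep p.2 := by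
      intro l
      by_cases h0 : (fun i => c i l) = 0
      -- If `P_l` occurs in no row, its coefficient vector defines no point of `ℙ^k`; any `N_l`
      -- works, with weight `0`.
      · refine ⟨Projectivization.mk K (fun _ => 1) (fun h => one_ne_zero (congrFun h 0)), 0, ?_⟩
        intro p
        rw [show c p.1 l = 0 from congrFun h0 p.1, zero_mul, zero_mul]
      · obtain ⟨a, ha⟩ := Projectivization.exists_smul_eq_mk_rep K _ h0
        obtain ⟨b, hb⟩ := exists_segre_rep (Projectivization.mk K _ h0) (P l)
        -- The weight undoes the two rescalings `a` and `b` caused by the choice of representatives.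
        refine ⟨Projectivization.mk K _ h0, (b : K)⁻¹ * (a : K)⁻¹, fun p => ?_⟩
        have ha' : (Projectivization.mk K _ h0).rep p.1 = (a : K) * c p.1 l :=
          (congrFun ha p.1).symm
        have := a.ne_zero
        have := b.ne_zero
        rw [hb, ha']
        field_simp
    choose N t hNt using hN
    refine ⟨N, t, ?_⟩
    ext p
    have := congrFun (hc p.1) p.2
    simp only [Finset.sum_apply, Pi.smul_apply, smul_eq_mul] at this ⊢
    rw [← this]
    exact Finset.sum_congr rfl fun l _ => hNt l p
  · rintro ⟨N, t, ht⟩ _ ⟨i, rfl⟩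
    have hb := fun l => exists_segre_rep (N l) (P l)
    choose b hb using hb
    refine (mem_linSpan_iff P _).2 ⟨fun l => t l * (b l * (N l).rep i), ?_⟩
    ext j
    have := congrFun ht (i, j)
    simp only [Finset.sum_apply, Pi.smul_apply, smul_eq_mul] at this ⊢
    rw [← this]
    refine Finset.sum_congr rfl fun l _ => ?_
    rw [hb]
    ring

theorem decompSpace_eq_decompPoint {r k s : ℕ} (X : Set (ℙ K (Fin (r + 1) → K)))
    {L : Grass K (min k (s - 1)) r} {B : ℙ K (Fin (k + 1) × Fin (r + 1) → K)}
    (hB : B ∈ phiFiber X k s L) : decompSpace X s L = decompPoint X s B := by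
  obtain ⟨A, rfl, rfl⟩ := hB
  ext P
  exact and_congr_right fun _ => rowSpan_le_linSpan_iff A.1 P

theorem segre_right_injective {ι κ : Type*} {a b : ℙ K (κ → K)} {x y : ℙ K (ι → K)}
    (h : segre a x = segre b y) : x = y := by
  rw [segre, segre, Projectivization.mk_eq_mk_iff'] at h
  obtain ⟨c, hc⟩ := h
  obtain ⟨i, hi⟩ := Function.ne_iff.1 a.rep_nonzero
  rw [← x.mk_rep, ← y.mk_rep, Projectivization.mk_eq_mk_iff']
  refine ⟨(a.rep i)⁻¹ * (c * b.rep i), ?_⟩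
  ext j
  have := congrFun hc (i, j)
  simp only [Pi.smul_apply, smul_eq_mul, Pi.zero_apply] at this hi ⊢
  rw [mul_assoc, mul_assoc, this, inv_mul_cancel_left₀ hi]

/-- The secant variety asks for distinct points. The `N_i` are uncontrolled, but a Segre point
determines its second factor, so distinct `P_i` suffice. -/
theorem mem_secantVariety {r k s : ℕ} {X : Set (ℙ K (Fin (r + 1) → K))}
    {B : ℙ K (Fin (k + 1) × Fin (r + 1) → K)} {P : Fin s → ℙ K (Fin (r + 1) → K)}
    (hP : Projectivization.Independent P) (hPX : ∀ i, P i ∈ X) (hB : rowSpan B ≤ linSpan P) :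
    B ∈ {A | ∃ P : Fin s → ℙ K (Fin (k + 1) × Fin (r + 1) → K), Function.Injective P ∧
      (∀ i, P i ∈ segreVariety k X) ∧ A.submodule ≤ linSpan P} := by
  obtain ⟨N, hN⟩ := (rowSpan_le_linSpan_iff B P).1 hB
  have hinj : Function.Injective P := by
    rw [Projectivization.independent_iff] at hP
    intro i j hij
    exact hP.injective (congrArg Projectivization.rep hij)
  exact ⟨_, fun i j hij => hinj (segre_right_injective hij), fun i => ⟨N i, P i, hPX i, rfl⟩, hN⟩

/-! ### Plücker coordinates and frames -/

/-- Sorting the columns turns the minor into a signed Plücker coordinate; a repeated column makes it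
zero. -/
theorem exists_form_eval_pluecker {w r : ℕ} (g : Fin (w + 1) → Fin (r + 1)) :
    ∃ l : MvPolynomial (Fin (w + 1) ↪o Fin (r + 1)) K, l.IsHomogeneous 1 ∧
      ∀ v : Fin (w + 1) → Fin (r + 1) → K,
        eval (pluecker v) l = Matrix.det (Matrix.of fun i j => v i (g j)) := by
  by_cases hg : Function.Injective g
  · have hmono : StrictMono (g ∘ Tuple.sort g) :=
      (Tuple.monotone_sort g).strictMono_of_injective (hg.comp (Tuple.sort g).injective)
    refine ⟨C ((Equiv.Perm.sign (Tuple.sort g) : ℤ) : K) *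
      X (OrderEmbedding.ofStrictMono _ hmono), ?_, fun v => ?_⟩
    · have h := (isHomogeneous_C _ ((Equiv.Perm.sign (Tuple.sort g) : ℤ) : K)).mul
        (isHomogeneous_X K (OrderEmbedding.ofStrictMono _ hmono))
      rwa [zero_add] at h
    · have h := Matrix.det_permute' (Tuple.sort g) (Matrix.of fun i j => v i (g j))
      have h' : pluecker v (OrderEmbedding.ofStrictMono _ hmono) =
          ((Matrix.of fun i j => v i (g j)).submatrix id (Tuple.sort g)).det := rfl
      rw [map_mul, eval_C, eval_X, h', h, ← mul_assoc, ← Int.cast_mul]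
      simp
  · rw [Function.not_injective_iff] at hg
    obtain ⟨a, b, hab, hne⟩ := hg
    refine ⟨0, isHomogeneous_zero _ _ _, fun v => ?_⟩
    rw [map_zero, Matrix.det_zero_of_column_eq hne fun i => by simp [hab]]

/-- The frame obtained from `v` by Cramer's rule that is a multiple of the identity in the columns
`I`; its entries are Plücker coordinates of `v` up to sign. -/
def reducedFrame {w r : ℕ} (I : Fin (w + 1) → Fin (r + 1)) (v : Fin (w + 1) → Fin (r + 1) → K)
    (i : Fin (w + 1)) (j : Fin (r + 1)) : K :=
  Matrix.det (Matrix.of fun a b => v a (Function.update I i j b))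

theorem reducedFrame_eq_cramer {w r : ℕ} (I : Fin (w + 1) → Fin (r + 1))
    (v : Fin (w + 1) → Fin (r + 1) → K) (i : Fin (w + 1)) (j : Fin (r + 1)) :
    reducedFrame I v i j =
      Matrix.cramer (Matrix.of fun a b => v a (I b)) (fun a => v a j) i := by
  rw [Matrix.cramer_apply, reducedFrame]
  congr 1
  ext a b
  by_cases h : b = i
  · subst h; simp
  · simp [h]

/-- With `M` the submatrix of `v` in the columns `I`, the reduced frame is `adj(M) v`, and `M adj(M)
= det(M)` recovers `v`. -/
theorem span_reducedFrame {w r : ℕ} (I : Fin (w + 1) → Fin (r + 1))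
    (v : Fin (w + 1) → Fin (r + 1) → K) (h : Matrix.det (Matrix.of fun a b => v a (I b)) ≠ 0) :
    Submodule.span K (Set.range (reducedFrame I v)) = Submodule.span K (Set.range v) := by
  apply le_antisymm <;> rw [Submodule.span_le] <;> rintro _ ⟨i, rfl⟩
  · refine (Submodule.mem_span_range_iff_exists_fun K).2
      ⟨fun a => (Matrix.of fun a b => v a (I b)).adjugate i a, ?_⟩
    ext j
    rw [reducedFrame_eq_cramer, Matrix.cramer_eq_adjugate_mulVec]
    simp [Matrix.mulVec, dotProduct]
  · refine (Submodule.mem_span_range_iff_exists_fun K).2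
      ⟨fun a => (Matrix.det (Matrix.of fun a b => v a (I b)))⁻¹ * v i (I a), ?_⟩
    ext j
    have := congrFun (Matrix.mulVec_cramer (Matrix.of fun a b => v a (I b)) (fun a => v a j)) i
    simp only [Matrix.mulVec, dotProduct, Matrix.of_apply, ← reducedFrame_eq_cramer, Pi.smul_apply,
      smul_eq_mul] at this
    simp only [Finset.sum_apply, Pi.smul_apply, smul_eq_mul, mul_assoc]
    rw [← Finset.mul_sum, this, inv_mul_cancel_left₀ h]

theorem exists_frame {w r : ℕ} (L : Grass K w r) :
    ∃ v : Fin (w + 1) → Fin (r + 1) → K,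
      LinearIndependent K v ∧ Submodule.span K (Set.range v) = L.1 := by
  let b := Module.finBasisOfFinrankEq K L.1 L.2
  refine ⟨fun i => (b i : Fin (r + 1) → K),
    b.linearIndependent.map' L.1.subtype (Submodule.ker_subtype _), ?_⟩
  have : Set.range (fun i => (b i : Fin (r + 1) → K)) = L.1.subtype '' Set.range b := by
    rw [← Set.range_comp]; rfl
  rw [this, Submodule.span_image, b.span_eq, Submodule.map_subtype_top]

/-- Row rank equals column rank, so some columns of `v` form a basis of `K^(w+1)`. Hence the charts
cover the Grassmannian. -/
theorem exists_det_ne_zero {w r : ℕ} (v : Fin (w + 1) → Fin (r + 1) → K)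
    (hv : LinearIndependent K v) :
    ∃ I : Fin (w + 1) → Fin (r + 1), Matrix.det (Matrix.of fun a b => v a (I b)) ≠ 0 := by
  have hspan : Submodule.span K (Set.range (Matrix.of v).col) = ⊤ := by
    apply Submodule.eq_top_of_finrank_eq
    rw [← Matrix.rank_eq_finrank_span_cols, LinearIndependent.rank_matrix (M := Matrix.of v) hv]
    simp
  obtain ⟨κ, a, -, ha, hli⟩ := exists_linearIndependent' K (Matrix.of v).col
  rw [hspan] at ha
  let b := Module.Basis.mk hli ha.ge
  let e := (Pi.basisFun K (Fin (w + 1))).indexEquiv b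
  refine ⟨a ∘ e, ?_⟩
  have h : LinearIndependent K (Matrix.of fun i j => v i ((a ∘ e) j)).col :=
    hli.comp e e.injective
  rw [Matrix.linearIndependent_cols_iff_isUnit, Matrix.isUnit_iff_isUnit_det] at h
  exact h.ne_zero

theorem eval_smul_of_isHomogeneous {σ : Type*} {d : ℕ} {F : MvPolynomial σ K}
    (hF : F.IsHomogeneous d) (c : K) (x : σ → K) : eval (c • x) F = c ^ d * eval x F := by
  rw [eval_eq, eval_eq, Finset.mul_sum]
  refine Finset.sum_congr rfl fun m hm => ?_
  have hd : ∑ i ∈ m.support, m i = d := by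
    rw [← hF (mem_support_iff.1 hm), Finsupp.weight_apply]
    simp [Finsupp.sum]
  simp only [Pi.smul_apply, smul_eq_mul, mul_pow, Finset.prod_mul_distrib, Finset.prod_pow_eq_pow_sum,
    hd]
  ring

/-- Writing `v' = g v` multiplies the Plücker vector by `det g`, and a form of degree `d` by `(det
g)^d`; thus nonvanishing does not depend on the frame. -/
theorem eval_pluecker_ne_zero {w r d : ℕ} {F : MvPolynomial (Fin (w + 1) ↪o Fin (r + 1)) K}
    (hF : F.IsHomogeneous d) {v v' : Fin (w + 1) → Fin (r + 1) → K}
    (h : Submodule.span K (Set.range v') ≤ Submodule.span K (Set.range v))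
    (h' : eval (pluecker v') F ≠ 0) : eval (pluecker v) F ≠ 0 := by
  have hg : ∀ i, ∃ c : Fin (w + 1) → K, ∑ l, c l • v l = v' i := fun i =>
    (Submodule.mem_span_range_iff_exists_fun K).1 (h (Submodule.subset_span ⟨i, rfl⟩))
  choose g hg using hg
  have hp : pluecker v' = (Matrix.of g).det • pluecker v := by
    ext I
    rw [Pi.smul_apply, smul_eq_mul, pluecker, pluecker, ← Matrix.det_mul]
    congr 1
    ext i j
    simp [Matrix.mul_apply, ← hg]
  rw [hp, eval_smul_of_isHomogeneous hF] at h'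
  exact right_ne_zero_of_mul h'

/-! ### The fibres of `Φ` are nonempty -/

/-- The coordinate vector whose first `w + 1` rows are the `u i` and whose other rows vanish. -/
def padRows {w r : ℕ} (k : ℕ) (u : Fin (w + 1) → Fin (r + 1) → K)
    (p : Fin (k + 1) × Fin (r + 1)) : K :=
  if h : p.1.1 < w + 1 then u ⟨p.1.1, h⟩ p.2 else 0

theorem padRows_castLE {w r k : ℕ} (hwk : w ≤ k) (u : Fin (w + 1) → Fin (r + 1) → K)
    (i : Fin (w + 1)) (j : Fin (r + 1)) :
    padRows k u (Fin.castLE (Nat.succ_le_succ hwk) i, j) = u i j := by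
  simp [padRows, i.is_le.not_gt]

theorem span_padRows {w r k : ℕ} (hwk : w ≤ k) (u : Fin (w + 1) → Fin (r + 1) → K) :
    Submodule.span K (Set.range fun (i : Fin (k + 1)) (j : Fin (r + 1)) => padRows k u (i, j)) =
      Submodule.span K (Set.range u) := by
  apply le_antisymm <;> rw [Submodule.span_le] <;> rintro _ ⟨i, rfl⟩
  · by_cases h : i.1 < w + 1
    · refine Submodule.subset_span ⟨⟨i.1, h⟩, funext fun j => ?_⟩
      simp only [padRows, h, dif_pos]
    · have h0 : (fun j => padRows k u (i, j)) = 0 := by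
        ext j
        simp only [padRows, h, dif_neg, not_false_iff, Pi.zero_apply]
      change (fun j => padRows k u (i, j)) ∈ Submodule.span K (Set.range u)
      rw [h0]
      exact Submodule.zero_mem _
  · refine Submodule.subset_span ⟨Fin.castLE (Nat.succ_le_succ hwk) i, ?_⟩
    ext j
    exact padRows_castLE hwk u i j

/-- The open chart of the Grassmannian where the minor with columns `I` does not vanish. -/
def chart (K : Type*) [Field K] {w r : ℕ} (I : Fin (w + 1) → Fin (r + 1)) : Set (Grass K w r) :=
  {W | ∃ v : Fin (w + 1) → Fin (r + 1) → K,
    Submodule.span K (Set.range v) = W.1 ∧ Matrix.det (Matrix.of fun a b => v a (I b)) ≠ 0}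

theorem isOpen_chart {w r : ℕ} (I : Fin (w + 1) → Fin (r + 1)) : IsOpen (chart K I) := by
  obtain ⟨l, hl, hl'⟩ := exists_form_eval_pluecker (K := K) I
  refine TopologicalSpace.isOpen_generateFrom_of_mem ⟨1, l, hl, ?_⟩
  ext W
  exact exists_congr fun v => by rw [hl']

theorem chart_padRows_ne_zero {w r k : ℕ} (hwk : w ≤ k) {I : Fin (w + 1) → Fin (r + 1)}
    (W : chart K I) : padRows k (reducedFrame I W.2.choose) ≠ 0 := by
  intro h
  have hs := span_padRows hwk (reducedFrame I W.2.choose)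
  have h0 : (fun (i : Fin (k + 1)) (j : Fin (r + 1)) =>
      padRows k (reducedFrame I W.2.choose) (i, j)) = fun _ => 0 := by
    rw [h]; rfl
  rw [h0, span_reducedFrame _ _ W.2.choose_spec.2, W.2.choose_spec.1] at hs
  have hr := W.1.2
  rw [← hs, Set.range_const, Submodule.span_zero_singleton, finrank_bot] at hr
  exact absurd hr (Nat.succ_ne_zero w).symm

/-- A section of `Φ` over a chart of the Grassmannian. -/
noncomputable def chartSection {w r k : ℕ} (hwk : w ≤ k) (I : Fin (w + 1) → Fin (r + 1))
    (W : chart K I) : ℙ K (Fin (k + 1) × Fin (r + 1) → K) :=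
  Projectivization.mk K (padRows k (reducedFrame I W.2.choose)) (chart_padRows_ne_zero hwk W)

theorem rowSpan_chartSection {w r k : ℕ} (hwk : w ≤ k) (I : Fin (w + 1) → Fin (r + 1))
    (W : chart K I) : rowSpan (chartSection hwk I W) = W.1.1 := by
  rw [chartSection, rowSpan_mk, span_padRows hwk, span_reducedFrame _ _ W.2.choose_spec.2,
    W.2.choose_spec.1]

/-- The coordinates of the section are linear forms in the Plücker coordinates, so a form of degree
`d` on `ℙ^N` pulls back to a form of degree `d` in them. -/
theorem continuous_chartSection {w r k : ℕ} (hwk : w ≤ k) (I : Fin (w + 1) → Fin (r + 1)) :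
    Continuous (chartSection (K := K) hwk I) := by
  refine continuous_generateFrom_iff.2 ?_
  rintro _ ⟨d, F, hF, rfl⟩
  choose l hl hl' using exists_form_eval_pluecker (K := K) (w := w) (r := r)
  let f : Fin (k + 1) × Fin (r + 1) → MvPolynomial (Fin (w + 1) ↪o Fin (r + 1)) K := fun p =>
    if h : p.1.1 < w + 1 then l (Function.update I ⟨p.1.1, h⟩ p.2) else 0
  have hf : ∀ p, (f p).IsHomogeneous 1 := by
    intro p
    by_cases h : p.1.1 < w + 1
    · simpa only [f, h, dif_pos] using hl _
    · simpa only [f, h, dif_neg, not_false_iff] using isHomogeneous_zero _ _ _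
  have hf' : ∀ v, eval (pluecker v) (aeval f F) = eval (padRows k (reducedFrame I v)) F := by
    intro v
    have e : (fun p => eval (pluecker v) (f p)) = padRows k (reducedFrame I v) := by
      ext p
      by_cases h : p.1.1 < w + 1
      · simp only [f, h, dif_pos, padRows, hl', reducedFrame]
      · simp only [f, h, dif_neg, padRows, map_zero, not_false_iff]
    rw [← e]
    exact aeval_bind₁ (pluecker v) f F
  have hG := hF.aeval f hf
  refine ⟨{W | ∃ v : Fin (w + 1) → Fin (r + 1) → K,
    Submodule.span K (Set.range v) = W.1 ∧ eval (pluecker v) (aeval f F) ≠ 0},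
    TopologicalSpace.isOpen_generateFrom_of_mem ⟨_, _, hG, rfl⟩, ?_⟩
  ext W
  obtain ⟨c, hc⟩ := Projectivization.exists_smul_eq_mk_rep K _ (chart_padRows_ne_zero hwk W)
  have hrep : eval (chartSection hwk I W).rep F =
      (c : K) ^ d * eval (padRows k (reducedFrame I W.2.choose)) F := by
    rw [← eval_smul_of_isHomogeneous hF, chartSection, ← hc]
    rfl
  simp only [Set.mem_preimage, Set.mem_ofPred_eq, hrep, ne_eq, mul_eq_zero,
    pow_eq_zero_iff', c.ne_zero, false_and, false_or]
  rw [← hf']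
  constructor
  -- The frame `v` need not be the one chosen in the section, but both span `W`.
  · rintro ⟨v, hv, h⟩
    exact eval_pluecker_ne_zero hG (hv.trans W.2.choose_spec.1.symm).le h
  · intro h
    exact ⟨_, W.2.choose_spec.1, h⟩

theorem phiFiber_nonempty {r k s : ℕ} (X : Set (ℙ K (Fin (r + 1) → K)))
    {L : Grass K (min k (s - 1)) r} (hL : L ∈ grassmannSecant X (min k (s - 1)) s) :
    (phiFiber X k s L).Nonempty := by
  obtain ⟨v, hv, hvL⟩ := exists_frame L
  obtain ⟨I, hI⟩ := exists_det_ne_zero v hv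
  have hwk : min k (s - 1) ≤ k := min_le_left _ _
  let W : chart K I := ⟨L, v, hvL, hI⟩
  have hW : chartSection hwk I W ∈ secantVariety (segreVariety k X) s := by
    -- Since the chart is open, `W` is a limit, within the chart, of subspaces of spans of
    -- independent points of `X`.
    refine map_mem_closure (continuous_chartSection hwk I)
      ((isOpen_chart I).isOpenMap_subtype_val.preimage_closure_subset_closure_preimage
        (show W ∈ Subtype.val ⁻¹' _ from hL)) ?_
    rintro W' ⟨P, hP, hPX, hWP⟩
    exact mem_secantVariety hP hPX ((rowSpan_chartSection hwk I W').trans_le hWP)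
  refine ⟨chartSection hwk I W, ⟨_, hW, ?_⟩, Subtype.ext (rowSpan_chartSection hwk I W), rfl⟩
  rw [rowSpan_chartSection]
  exact L.2

/-- As `X` spans, it contains `r + 1 ≥ s` independent points; the first `w + 1 ≤ s` of them span a
suitable subspace. -/
theorem grassmannSecant_nonempty {r k s : ℕ} (hs : 1 ≤ s) (hsr : s - 1 ≤ r)
    {X : Set (ℙ K (Fin (r + 1) → K))} (hX : linSpan (fun P : X => P.1) = ⊤) :
    (grassmannSecant X (min k (s - 1)) s).Nonempty := by
  have hspan : Submodule.span K (Set.range fun P : X => P.1.rep) = ⊤ := by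
    rw [← hX, linSpan, Submodule.span_range_eq_iSup]
    simp only [Projectivization.submodule_eq]
  obtain ⟨κ, a, -, ha, hli⟩ := exists_linearIndependent' K fun P : X => P.1.rep
  rw [hspan] at ha
  let e := ((Pi.basisFun K (Fin (r + 1))).indexEquiv (Module.Basis.mk hli ha.ge))
  have hsr' : s ≤ r + 1 := by omega
  let P : Fin s → X := fun i => a (e (Fin.castLE hsr' i))
  have hP : LinearIndependent K fun i => (P i).1.rep :=
    hli.comp (fun i => e (Fin.castLE hsr' i)) (e.injective.comp (Fin.castLE_injective hsr'))
  have hws : min k (s - 1) + 1 ≤ s := by omega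
  have hv : LinearIndependent K fun i => (P (Fin.castLE hws i)).1.rep :=
    hP.comp _ (Fin.castLE_injective hws)
  refine ⟨⟨Submodule.span K (Set.range fun i => (P (Fin.castLE hws i)).1.rep), ?_⟩,
    subset_closure ⟨fun i => (P i).1, Projectivization.independent_iff.2 hP, fun i => (P i).2, ?_⟩⟩
  · rw [finrank_span_eq_card hv, Fintype.card_fin]
  · rw [Submodule.span_le]
    rintro _ ⟨i, rfl⟩
    refine Submodule.mem_iSup_of_mem (Fin.castLE hws i) ?_
    rw [Projectivization.submodule_eq]
    exact Submodule.mem_span_singleton_self _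

theorem forGeneral_of_forall {α : Type*} [TopologicalSpace α] {T : Set α} {p : α → Prop}
    (hT : T.Nonempty) (h : ∀ x ∈ T, p x) : ForGeneral T p :=
  ⟨∅, isClosed_empty, by simpa using hT, by simpa using subset_closure, fun x hx => h x hx.1⟩

end GrassmannSecant

theorem proposition3p4 {K : Type*} [Field K] [IsAlgClosed K] [CharZero K] (r k s : ℕ)
    (hs : 1 ≤ s) (hsr : s - 1 ≤ r) (X : Set (ℙ K (Fin (r + 1) → K)))
    (hX : IsNondegenerateVariety X) :
    ForGeneral (grassmannSecant X (min k (s - 1)) s) fun L =>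
      ForGeneral (phiFiber X k s L) fun B =>
        Cardinal.mk (decompSpace X s L) = Cardinal.mk (decompPoint X s B) := by
  refine forGeneral_of_forall (grassmannSecant_nonempty hs hsr hX.span_eq_top) fun L hL =>
    forGeneral_of_forall (phiFiber_nonempty X hL) fun B hB => ?_
  rw [decompSpace_eq_decompPoint X hB]
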